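/- Let $X$ be a Tychonoff space (completely regular and Hausdorff). Let $C_p(X)$ be the space of real-valued continuous functions on $X$ with the topology of pointwise convergence, and let $c_0=\{(x_n)\in\mathbb R^{\mathbb N}: x_n\to 0\}$ carry the topology inherited from the product $\mathbb R^{\mathbb N}$. A finitely supported sign-measure on $X$ is a formal finite linear combination $\mu=\sum_{x\in F}\alpha_x\delta_x$ of Dirac measures, with $F\subset X$ finite and all $\alpha_x\in\mathbb R\setminus\{0\}$; put $\|\mu\|=\sum_{x\in F}|\alpha_x|$ and $\mu(f)=\sum_{x\in F}\alpha_x f(x)$. The space $C_p(X)$ has the Josefson–Nissenzweig property (JNP) if there is a sequence $(\mu_n)_{n\in\mathbb N}$ of finitely supported sign-measures on $X$ with $\|\mu_n\|=1$ for all $n$ and $\mu_n(f)\to 0$ for every $f\in C_p(X)$. A linear subspace is complemented if it is the range of a continuous linear projection; a quotient of $C_p(X)$ is a space $C_p(X)/Z$ with $Z$ a closed linear subspace and the quotient topology; isomorphic means linearly homeomorphic. A locally convex space is Polishable if it admits a stronger (that is, finer or equal) separable Fréchet (complete metrizable locally convex) topology. Theorem. The following conditions are equivalent: 1. $C_p(X)$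 has the JNP; 2. $C_p(X)$ contains a complemented subspace isomorphic to $c_0$; 3. $C_p(X)$ has a quotient isomorphic to $c_0$. If moreover $X$ is pseudocompact (every continuous real-valued function on $X$ is bounded), then conditions 1–3 are also equivalent to each of the following: 4. $C_p(X)$ contains a complemented infinite-dimensional metrizable subspace; 5. $C_p(X)$ contains a complemented infinite-dimensional separable subspace; 6. $C_p(X)$ has an infinite-dimensional Polishable quotient. -/

import Mathlib

open Filter Topology

/-- `C_p(X)`: the real continuous functions on `X`, as a linear subspace of the product `ℝ^X`.
Being a submodule of `X → ℝ`, it carries the topology of pointwise convergence. -/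
def Cp (X : Type*) [TopologicalSpace X] : Submodule ℝ (X → ℝ) where
  carrier := {f | Continuous f}
  add_mem' := fun hf hg => Continuous.add hf hg
  zero_mem' := continuous_zero
  smul_mem' := fun c _ hf => Continuous.const_smul hf c

/-- `c₀`: the real sequences converging to `0`, as a linear subspace of `ℝ^ℕ` with the
(subspace topology of the) product topology. -/
def c0 : Submodule ℝ (ℕ → ℝ) where
  carrier := {x | Tendsto x atTop (𝓝 0)}
  add_mem' := fun hx hy => by
    have h := Tendsto.add hx hy
    rwa [add_zero] at h
  zero_mem' := tendsto_const_nhds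
  smul_mem' := fun c _ hx => by
    have h := Tendsto.const_smul hx c
    rwa [smul_zero] at h

/-- A finitely supported sign-measure `∑ x ∈ F, α x • δ_x` on `X`, given by its coefficients. -/
abbrev SignMeasure (X : Type*) := X →₀ ℝ

namespace SignMeasure

/-- The norm `‖μ‖ = ∑ x ∈ supp μ, |α x|`. -/
def totalNorm {X : Type*} (μ : SignMeasure X) : ℝ := ∑ x ∈ μ.support, |μ x|

/-- The value `μ(f) = ∑ x ∈ supp μ, α x * f x`. -/
def eval {X : Type*} (μ : SignMeasure X) (f : X → ℝ) : ℝ := ∑ x ∈ μ.support, μ x * f x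

end SignMeasure

/-- The Josefson–Nissenzweig property of `C_p(X)`. -/
def HasJNP (X : Type*) [TopologicalSpace X] : Prop :=
  ∃ μ : ℕ → SignMeasure X, (∀ n, (μ n).totalNorm = 1) ∧
    ∀ f ∈ Cp X, Tendsto (fun n => (μ n).eval f) atTop (𝓝 0)

/-- Every continuous real-valued function on `X` is bounded. -/
def IsPseudocompact (X : Type*) [TopologicalSpace X] : Prop :=
  ∀ f : X → ℝ, Continuous f → ∃ M : ℝ, ∀ x, |f x| ≤ M

/-- A separable Fréchet space: a separable metrizable locally convex real topological vector
space, complete in the uniformity of its additive group (which `IsUniformAddGroup` forces `u`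
to be). -/
structure IsSeparableFrechet (E : Type*) [AddCommGroup E] [Module ℝ E] [u : UniformSpace E] :
    Prop where
  uniformAddGroup : IsUniformAddGroup E
  continuousSMul : ContinuousSMul ℝ E
  locallyConvex : LocallyConvexSpace ℝ E
  metrizable : TopologicalSpace.MetrizableSpace E
  complete : CompleteSpace E
  separable : TopologicalSpace.SeparableSpace E

/-- A (locally convex) space with topology `t` is Polishable if it admits a separable Fréchet
locally convex topology that is stronger than (finer than or equal to) `t`. -/
def IsPolishable (E : Type*) [AddCommGroup E] [Module ℝ E] [t : TopologicalSpace E] : Prop :=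
  ∃ u : UniformSpace E, u.toTopologicalSpace ≤ t ∧ IsSeparableFrechet E (u := u)

/-! From the JNP to a complemented `c0`: a gliding hump. Let `μ n` be normalized and weakly null.
Every sign pattern on a finite set extends to a continuous function bounded by 1, so the measures
cannot concentrate on a finite set: eventually mass more than 1/4 lies outside it. Hence there are
disjointly supported bumps on which a subsequence takes values at least 1/8, later bumps vanish on
earlier supports, and later measures are small on earlier bumps. Solving the resulting triangular
system makes the measures exactly biorthogonal to the rescaled bumps and keeps them weakly null.
Then `f ↦ (ν n f)` maps `Cp X` to `c0`, with right inverse `x ↦ ∑ x k • g k`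
(`SignMeasure.exists_biorthogonal`). Dividing by a closed complement gives the quotient.

From a `c0` quotient back to the JNP: its coordinates are weakly null sign-measures. If their norms
do not tend to 0, normalize a subsequence. Otherwise surjectivity yields `f` with `μ n f = √‖μ n‖`,
so `f` grows without bound on the supports; `SignMeasure.not_forall_eventually_exists_support_gt`
excludes this.

In the pseudocompact case, choose normalized measures killing `Z` and the first `n` terms of a dense
sequence. Convergence to 0 passes from the dense sequence to all functions: by uniform density for a
separable complemented subspace, by Banach–Steinhaus for a Polishable quotient. -/

namespace SignMeasure

variable {X : Type*}

/-! ### Evaluation, norm and variation of sign-measures -/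

theorem eval_eq_linearCombination (μ : SignMeasure X) (f : X → ℝ) :
    μ.eval f = Finsupp.linearCombination ℝ f μ := rfl

theorem eval_sub_left (μ ν : SignMeasure X) (f : X → ℝ) :
    (μ - ν).eval f = μ.eval f - ν.eval f := by
  simp only [eval_eq_linearCombination, map_sub]

theorem eval_smul_left (c : ℝ) (μ : SignMeasure X) (f : X → ℝ) :
    (c • μ).eval f = c * μ.eval f := by
  simp only [eval_eq_linearCombination, map_smul, smul_eq_mul]

theorem eval_sum_left {ι : Type*} (s : Finset ι) (μ : ι → SignMeasure X) (f : X → ℝ) :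
    SignMeasure.eval (∑ i ∈ s, μ i) f = ∑ i ∈ s, (μ i).eval f := by
  simp only [eval_eq_linearCombination, map_sum]

theorem eval_add_right (μ : SignMeasure X) (f g : X → ℝ) :
    μ.eval (f + g) = μ.eval f + μ.eval g := by
  simp only [eval, Pi.add_apply, mul_add, Finset.sum_add_distrib]

theorem eval_sub_right (μ : SignMeasure X) (f g : X → ℝ) :
    μ.eval (f - g) = μ.eval f - μ.eval g := by
  simp only [eval, Pi.sub_apply, mul_sub, Finset.sum_sub_distrib]

theorem eval_smul_right (μ : SignMeasure X) (c : ℝ) (f : X → ℝ) :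
    μ.eval (c • f) = c * μ.eval f := by
  simp only [eval, Pi.smul_apply, smul_eq_mul, Finset.mul_sum]
  exact Finset.sum_congr rfl fun x _ => by ring

theorem eval_sum_right {ι : Type*} (μ : SignMeasure X) (s : Finset ι) (f : ι → X → ℝ) :
    μ.eval (fun x => ∑ i ∈ s, f i x) = ∑ i ∈ s, μ.eval (f i) := by
  simp only [eval, Finset.mul_sum]
  exact Finset.sum_comm

theorem eval_congr (μ : SignMeasure X) {f g : X → ℝ} (h : ∀ x ∈ μ.support, f x = g x) :
    μ.eval f = μ.eval g :=
  Finset.sum_congr rfl fun x hx => by rw [h x hx]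

theorem eval_eq_zero (μ : SignMeasure X) {f : X → ℝ} (h : ∀ x ∈ μ.support, f x = 0) :
    μ.eval f = 0 :=
  Finset.sum_eq_zero fun x hx => by rw [h x hx, mul_zero]

theorem abs_eval_le (μ : SignMeasure X) {f : X → ℝ} {C : ℝ} (h : ∀ x ∈ μ.support, |f x| ≤ C) :
    |μ.eval f| ≤ C * μ.totalNorm := by
  refine (Finset.abs_sum_le_sum_abs _ _).trans ?_
  rw [totalNorm, Finset.mul_sum]
  refine Finset.sum_le_sum fun x hx => ?_
  rw [abs_mul, mul_comm]
  exact mul_le_mul_of_nonneg_right (h x hx) (abs_nonneg _)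

theorem totalNorm_pos {μ : SignMeasure X} (h : μ ≠ 0) : 0 < μ.totalNorm :=
  Finset.sum_pos (fun _ hx => abs_pos.2 (Finsupp.mem_support_iff.1 hx))
    (Finsupp.support_nonempty_iff.2 h)

theorem totalNorm_smul (c : ℝ) (μ : SignMeasure X) : (c • μ).totalNorm = |c| * μ.totalNorm := by
  rcases eq_or_ne c 0 with rfl | hc
  · simp [totalNorm]
  · simp only [totalNorm, Finsupp.support_smul_eq hc, Finsupp.smul_apply, smul_eq_mul, abs_mul,
      Finset.mul_sum]

theorem totalNorm_inv_smul {μ : SignMeasure X} (h : μ ≠ 0) :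
    (μ.totalNorm⁻¹ • μ).totalNorm = 1 := by
  have := totalNorm_pos h
  rw [totalNorm_smul, abs_of_pos (inv_pos.2 this), inv_mul_cancel₀ this.ne']

/-- The total variation `|μ|(B)` of a set `B`. -/
noncomputable def mass (μ : SignMeasure X) (B : Set X) : ℝ :=
  ∑ x ∈ μ.support, B.indicator (fun x => |μ x|) x

theorem mass_mono (μ : SignMeasure X) {A B : Set X} (h : A ⊆ B) : μ.mass A ≤ μ.mass B :=
  Finset.sum_le_sum fun _ _ => Set.indicator_le_indicator_of_subset h (fun _ => abs_nonneg _) _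

theorem mass_add_mass_compl (μ : SignMeasure X) (B : Set X) :
    μ.mass B + μ.mass Bᶜ = μ.totalNorm := by
  rw [mass, mass, totalNorm, ← Finset.sum_add_distrib]
  exact Finset.sum_congr rfl fun x _ => Set.indicator_self_add_compl_apply _ _ _

theorem mass_union_le (μ : SignMeasure X) (A B : Set X) :
    μ.mass (A ∪ B) ≤ μ.mass A + μ.mass B := by
  rw [mass, mass, mass, ← Finset.sum_add_distrib]
  refine Finset.sum_le_sum fun x _ => ?_
  by_cases hA : x ∈ A <;> by_cases hB : x ∈ B <;> simp [hA, hB]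

theorem mass_biUnion_le {ι : Type*} (μ : SignMeasure X) (s : Finset ι) (B : ι → Set X) :
    μ.mass (⋃ i ∈ s, B i) ≤ ∑ i ∈ s, μ.mass (B i) := by
  classical
  induction s using Finset.induction_on with
  | empty => simp [mass]
  | insert a s ha ih =>
    rw [Finset.set_biUnion_insert, Finset.sum_insert ha]
    exact (mass_union_le _ _ _).trans (by gcongr)

theorem sum_mass_le {ι : Type*} (μ : SignMeasure X) (s : Finset ι) (B : ι → Set X)
    (hB : (s : Set ι).PairwiseDisjoint B) : ∑ i ∈ s, μ.mass (B i) ≤ μ.totalNorm := by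
  classical
  rw [totalNorm]
  simp only [mass]
  rw [Finset.sum_comm]
  refine Finset.sum_le_sum fun x _ => ?_
  by_cases h : ∃ i ∈ s, x ∈ B i
  · obtain ⟨i, hi, hx⟩ := h
    rw [Finset.sum_eq_single_of_mem i hi]
    · exact Set.indicator_le_self' (fun _ _ => abs_nonneg _) _
    · intro j hj hji
      exact Set.indicator_of_notMem
        (fun hxj => Set.disjoint_left.1 (hB hj hi hji) hxj hx) _
  · push Not at h
    rw [Finset.sum_eq_zero fun i hi => Set.indicator_of_notMem (h i hi) _]
    exact abs_nonneg _

theorem abs_eval_le_mass (μ : SignMeasure X) {f : X → ℝ} {B : Set X} (h1 : ∀ x, |f x| ≤ 1)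
    (h0 : ∀ x ∉ B, f x = 0) : |μ.eval f| ≤ μ.mass B := by
  refine (Finset.abs_sum_le_sum_abs _ _).trans (Finset.sum_le_sum fun x _ => ?_)
  by_cases hx : x ∈ B
  · rw [Set.indicator_of_mem hx, abs_mul]
    exact mul_le_of_le_one_right (abs_nonneg _) (h1 x)
  · simp [h0 x hx, hx]

/-- A function that agrees with the sign of `μ` on `B` nearly realizes the mass of `B`. -/
theorem mass_sub_mass_compl_le_eval (μ : SignMeasure X) {f : X → ℝ} {B : Set X}
    (h1 : ∀ x, |f x| ≤ 1) (hB : ∀ x ∈ B, f x = SignType.sign (μ x)) :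
    μ.mass B - μ.mass Bᶜ ≤ μ.eval f := by
  rw [mass, mass, ← Finset.sum_sub_distrib]
  refine Finset.sum_le_sum fun x _ => ?_
  by_cases hx : x ∈ B
  · simp [hx, hB x hx]
  · have : |μ x * f x| ≤ |μ x| := by
      rw [abs_mul]
      exact mul_le_of_le_one_right (abs_nonneg _) (h1 x)
    simpa [hx] using (abs_le.1 this).1

theorem eval_eq_mass (μ : SignMeasure X) {f : X → ℝ} {B : Set X}
    (hB : ∀ x ∈ B, f x = SignType.sign (μ x)) (h0 : ∀ x ∈ μ.support, x ∉ B → f x = 0) :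
    μ.eval f = μ.mass B := by
  refine Finset.sum_congr rfl fun x hxμ => ?_
  by_cases hx : x ∈ B
  · simp [hx, hB x hx]
  · simp [hx, h0 x hxμ hx]

end SignMeasure

/-! ### Interpolation and bumps with small mass -/

/-- A continuous function on a completely regular space interpolating prescribed values on a finite
set and supported in a prescribed neighbourhood of it. -/
theorem exists_continuous_interpolation {X : Type*} [TopologicalSpace X] [T35Space X]
    (F : Finset X) {W : Set X} (hW : IsOpen W) (hFW : (F : Set X) ⊆ W) (σ : X → ℝ)
    (hσ : ∀ x, |σ x| ≤ 1) :
    ∃ f : X → ℝ, Continuous f ∧ (∀ x, |f x| ≤ 1) ∧ (∀ x ∈ F, f x = σ x) ∧ tsupport f ⊆ W := by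
  classical
  obtain ⟨V, hVo, hFV, hVW⟩ := F.finite_toSet.isCompact.exists_isOpen_closure_subset
    (hW.mem_nhdsSet.2 hFW)
  have key : ∀ x ∈ F, ∃ g : X → ℝ, Continuous g ∧ g x = 1 ∧ (∀ y ∈ F, y ≠ x → g y = 0) ∧
      ∀ y ∉ V, g y = 0 := by
    intro x hx
    have hK : IsClosed (Vᶜ ∪ ((F.erase x : Finset X) : Set X)) :=
      hVo.isClosed_compl.union (Finset.finite_toSet _).isClosed
    obtain ⟨f, hf, hfx, hfK⟩ := CompletelyRegularSpace.completely_regular x _ hK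
      (by simpa using hFV hx)
    refine ⟨fun y => 1 - f y, by fun_prop, by simp [hfx], fun y hy hyx => ?_, fun y hy => ?_⟩
    · have : f y = 1 := hfK (Or.inr (by simpa using ⟨hy, hyx⟩))
      simp [this]
    · have : f y = 1 := hfK (Or.inl hy)
      simp [this]
  choose! g hgc hg1 hg0 hgV using key
  -- Truncation to [-1, 1] changes neither the prescribed values nor the zeros outside `V`.
  let h : X → ℝ := fun y => max (-1) (min 1 (∑ x ∈ F, σ x * g x y))
  have hhV : ∀ y ∉ V, h y = 0 := fun y hy => by
    have : ∑ x ∈ F, σ x * g x y = 0 :=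
      Finset.sum_eq_zero fun x hx => by rw [hgV x hx y hy, mul_zero]
    simp [h, this]
  refine ⟨h, ?_, fun y => abs_le.2 ⟨le_max_left _ _, max_le (by norm_num) (min_le_left _ _)⟩,
    fun x hx => ?_, ?_⟩
  · refine continuous_const.max (continuous_const.min (continuous_finsetSum _ fun x hx => ?_))
    exact continuous_const.mul (hgc x hx)
  · have : ∑ z ∈ F, σ z * g z x = σ x := by
      rw [Finset.sum_eq_single_of_mem x hx, hg1 x hx, mul_one]
      intro z hz hzx
      rw [hg0 z hz x hx hzx.symm, mul_zero]
    simp only [h, this]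
    rw [min_eq_right (abs_le.1 (hσ x)).2, max_eq_right (abs_le.1 (hσ x)).1]
  · refine (closure_mono fun y hy => ?_).trans hVW
    by_contra hyV
    exact hy (hhV y hyV)

/-- A recursive construction of sequences whose history is recorded by good finite sets. -/
theorem exists_seq_of_forall_good_finset {α : Type*} [DecidableEq α] (G : Finset α → Prop)
    (r : α → α → Prop) (h0 : G ∅)
    (h : ∀ s, G s → ∃ y, G (insert y s) ∧ ∀ x ∈ s, r x y) :
    ∃ f : ℕ → α, (∀ n, ∃ s, G s ∧ f n ∈ s) ∧ ∀ m n, m < n → r (f m) (f n) := by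
  have : Nonempty α := ⟨(h ∅ h0).choose⟩
  choose! y hyG hyr using h
  let S : ℕ → Finset α := fun n => Nat.rec ∅ (fun _ s => insert (y s) s) n
  have hS : ∀ n, S (n + 1) = insert (y (S n)) (S n) := fun n => rfl
  have hG : ∀ n, G (S n) := fun n => by
    induction n with
    | zero => exact h0
    | succ n ih => rw [hS]; exact hyG _ ih
  have hmono : Monotone S := monotone_nat_of_le_succ fun n => by
    rw [hS]; exact Finset.subset_insert _ _
  have hmem : ∀ n, y (S n) ∈ S (n + 1) := fun n => by
    rw [hS]; exact Finset.mem_insert_self _ _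
  exact ⟨fun n => y (S n), fun n => ⟨S (n + 1), hG (n + 1), hmem n⟩,
    fun m n hmn => hyr _ (hG n) _ (hmono hmn (hmem m))⟩

namespace SignMeasure

variable {X : Type*} [TopologicalSpace X] [T35Space X]

/-- A normalized weakly null sequence of sign-measures keeps a fixed mass outside each finite
set. -/
theorem eventually_mass_compl_gt {μ : ℕ → SignMeasure X} (h1 : ∀ n, (μ n).totalNorm = 1)
    (h0 : ∀ f : X → ℝ, Continuous f → Tendsto (fun n => (μ n).eval f) atTop (𝓝 0))
    (A : Finset X) : ∀ᶠ n in atTop, 1 / 4 < (μ n).mass (A : Set X)ᶜ := by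
  classical
  -- One test function per sign pattern on `A`: there are finitely many, so a single tail of the
  -- sequence serves them all, including the pattern of `μ n` itself.
  have key : ∀ P : A → SignType, ∃ f : X → ℝ, Continuous f ∧ (∀ x, |f x| ≤ 1) ∧
      ∀ x : A, f x = P x := by
    intro P
    obtain ⟨f, hf, hf1, hfA, -⟩ := exists_continuous_interpolation A isOpen_univ
      (Set.subset_univ _) (fun x => if hx : x ∈ A then (P ⟨x, hx⟩ : ℝ) else 0) (fun x => by
        split_ifs with hx
        · cases P ⟨x, hx⟩ <;> simp
        · simp)
    exact ⟨f, hf, hf1, fun x => by simp [hfA x x.2]⟩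
  choose f hfc hf1 hfA using key
  have hev : ∀ᶠ n in atTop, ∀ P : A → SignType, (μ n).eval (f P) < 1 / 2 :=
    eventually_all.2 fun P => (h0 _ (hfc P)).eventually (gt_mem_nhds (by norm_num))
  filter_upwards [hev] with n hn
  have h2 := mass_sub_mass_compl_le_eval (μ n) (B := (A : Set X))
    (hf1 fun x => SignType.sign (μ n x)) (fun x hx => hfA _ ⟨x, hx⟩)
  have h3 := hn fun x => SignType.sign (μ n x)
  have h4 := (μ n).mass_add_mass_compl (A : Set X)
  rw [h1 n] at h4
  linarith

/-- Among sufficiently many measures with large mass outside a closed set `C`, some one is carried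
by an open set to which the other measures give little mass. -/
theorem exists_bump {μ : ℕ → SignMeasure X} (h1 : ∀ n, (μ n).totalNorm = 1)
    (hμ : ∀ A : Finset X, ∀ᶠ n in atTop, 1 / 4 < (μ n).mass (A : Set X)ᶜ)
    (𝒰 : Ultrafilter ℕ) (h𝒰 : (𝒰 : Filter ℕ) ≤ atTop) {C : Set X} (hC : IsClosed C)
    {E : Set ℕ} (hE : E ∈ 𝒰) (hEC : ∀ n ∈ E, (μ n).mass C ≤ 1 / 8) (A : Finset X)
    {η : ℝ} (hη : 0 < η) :
    ∃ n ∈ E, ∃ f : X → ℝ, Continuous f ∧ (∀ x, |f x| ≤ 1) ∧ (∀ x ∈ A, f x = 0) ∧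
      Disjoint (tsupport f) C ∧ 1 / 8 ≤ (μ n).eval f ∧
      ∀ᶠ m in 𝒰, (μ m).mass (tsupport f) ≤ η := by
  classical
  -- Disjoint finite pieces of supports avoiding `A` and `C`; the mass 1/8 is what remains of 1/4
  -- after removing `C`.
  obtain ⟨p, hp, hpr⟩ := exists_seq_of_forall_finset_exists
    (fun p : ℕ × Finset X => p.1 ∈ E ∧ 1 / 8 ≤ (μ p.1).mass p.2 ∧ Disjoint p.2 A ∧
      Disjoint (p.2 : Set X) C)
    (fun p q => Disjoint p.2 q.2) (by
      intro s _
      let B := A ∪ s.biUnion Prod.snd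
      obtain ⟨n, hnE, hn⟩ := (𝒰.nonempty_of_mem (inter_mem hE (h𝒰 (hμ B))))
      refine ⟨(n, {x ∈ (μ n).support | x ∉ B ∧ x ∉ C}), ⟨hnE, ?_, ?_, ?_⟩, fun q hq => ?_⟩
      · have hsub : (μ n).mass (B : Set X)ᶜ ≤ (μ n).mass (({x ∈ (μ n).support | x ∉ B ∧ x ∉ C} :
            Finset X) : Set X) + (μ n).mass C := by
          rw [mass, mass, mass, ← Finset.sum_add_distrib]
          refine Finset.sum_le_sum fun x hx => ?_
          by_cases hxB : x ∈ B <;> by_cases hxC : x ∈ C <;>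
            simp [hxB, hxC, Finsupp.mem_support_iff.1 hx]
        have := hEC n hnE
        have hn : 1 / 4 < (μ n).mass (B : Set X)ᶜ := hn
        linarith
      · rw [Finset.disjoint_left]
        intro x hx hxA
        exact (Finset.mem_filter.1 hx).2.1 (Finset.mem_union_left _ hxA)
      · rw [Set.disjoint_left]
        intro x hx hxC
        exact (Finset.mem_filter.1 hx).2.2 hxC
      · rw [Finset.disjoint_left]
        intro x hx hx'
        exact (Finset.mem_filter.1 hx').2.1
          (Finset.mem_union_right _ (Finset.mem_biUnion.2 ⟨q, hq, hx⟩)))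
  have hdisj : ∀ i j, i ≠ j → Disjoint (p i).2 (p j).2 := fun i j hij => by
    rcases lt_or_gt_of_ne hij with h | h
    · exact hpr i j h
    · exact (hpr j i h).symm
  obtain ⟨N, hN⟩ := exists_nat_gt (1 / η)
  have hN0 : 0 < N := by
    have : (0 : ℝ) < N := lt_trans (by positivity) hN
    exact_mod_cast this
  obtain ⟨U, hU, hUd⟩ := ((Finset.range N).biUnion fun i => (p i).2).finite_toSet.t2_separation
  have hbd : ∀ i, IsClosed (((((μ (p i).1).support ∪ A) \ (p i).2 : Finset X)) : Set X) :=
    fun i => (Finset.finite_toSet _).isClosed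
  let V : ℕ → Set X := fun i => ⋃ x ∈ (p i).2, U x
  -- Deleting the rest of the support makes the bump see only the chosen piece, so its value is
  -- exactly the mass of that piece.
  let W : ℕ → Set X := fun i => V i ∩ Cᶜ ∩
    (((((μ (p i).1).support ∪ A) \ (p i).2 : Finset X)) : Set X)ᶜ
  have hWo : ∀ i, IsOpen (W i) := fun i =>
    ((isOpen_biUnion fun x _ => (hU x).2).inter hC.isOpen_compl).inter (hbd i).isOpen_compl
  have hFW : ∀ i, ((p i).2 : Set X) ⊆ W i := fun i x hx => by
    refine ⟨⟨Set.mem_biUnion hx (hU x).1, fun hxC => Set.disjoint_left.1 (hp i).2.2.2 hx hxC⟩, ?_⟩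
    simp only [Set.mem_compl_iff, Finset.mem_coe, Finset.mem_sdiff, not_and, not_not]
    exact fun _ => hx
  have key : ∀ i, ∃ f : X → ℝ, Continuous f ∧ (∀ x, |f x| ≤ 1) ∧
      (∀ x ∈ (p i).2, f x = SignType.sign (μ (p i).1 x)) ∧ tsupport f ⊆ W i := fun i =>
    exists_continuous_interpolation _ (hWo i) (hFW i) _ fun x => by
      cases SignType.sign (μ (p i).1 x) <;> simp
  choose f hfc hf1 hfF hfW using key
  have hVd : ((Finset.range N : Finset ℕ) : Set ℕ).PairwiseDisjoint V := by
    intro i hi j hj hij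
    simp only [Function.onFun, V, Set.disjoint_iUnion_left, Set.disjoint_iUnion_right]
    intro x hx y hy
    refine hUd (by simpa using ⟨i, by simpa using hi, hy⟩)
      (by simpa using ⟨j, by simpa using hj, hx⟩) ?_
    rintro rfl
    exact Finset.disjoint_left.1 (hdisj i j hij) hy hx
  -- A measure of norm 1 cannot give mass above `η` to `N > 1/η` disjoint sets.
  have hpig : ∀ m, ∃ i ∈ ((Finset.range N : Finset ℕ) : Set ℕ),
      (μ m).mass (tsupport (f i)) ≤ η := by
    intro m
    by_contra! hcon
    have hle := sum_mass_le (μ m) (Finset.range N) V hVd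
    have hlt : ∑ i ∈ Finset.range N, η ≤ ∑ i ∈ Finset.range N, (μ m).mass (V i) :=
      Finset.sum_le_sum fun i hi => (hcon i hi).le.trans
        (mass_mono _ ((hfW i).trans fun x hx => hx.1.1))
    rw [Finset.sum_const, Finset.card_range, nsmul_eq_mul] at hlt
    rw [h1] at hle
    rw [div_lt_iff₀ hη] at hN
    linarith
  -- The good index depends on `m` but has finitely many values, so the ultrafilter selects one
  -- index for almost all `m`.
  obtain ⟨i, -, hi⟩ := (Ultrafilter.eventually_exists_mem_iff (f := 𝒰)
    (Finset.finite_toSet _)).1 (Eventually.of_forall hpig)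
  have hz : ∀ x ∉ W i, f i x = 0 := fun x hx => image_eq_zero_of_notMem_tsupport
    fun hx' => hx (hfW i hx')
  refine ⟨(p i).1, (hp i).1, f i, hfc i, hf1 i, fun x hx => hz x fun hxW => hxW.2 ?_, ?_, ?_, hi⟩
  · simp only [Finset.mem_coe, Finset.mem_sdiff, Finset.mem_union]
    exact ⟨Or.inr hx, Finset.disjoint_right.1 (hp i).2.2.1 hx⟩
  · exact Set.disjoint_left.2 fun x hx => (hfW i hx).1.2
  · rw [eval_eq_mass (μ (p i).1) (B := (p i).2) (hfF i)]
    · exact (hp i).2.1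
    · intro x hx hxF
      refine hz x fun hxW => hxW.2 ?_
      simp only [Finset.mem_coe, Finset.mem_sdiff, Finset.mem_union]
      exact ⟨Or.inl hx, hxF⟩

end SignMeasure

/-! ### Triangular systems -/

/-- The solution `v` of the triangular system `v j + ∑ k < j, A j k • v k = m j`. -/
noncomputable def triangularSolution {M : Type*} [AddCommGroup M] [Module ℝ M] (m : ℕ → M)
    (A : ℕ → ℕ → ℝ) : ℕ → M
  | j => m j - ∑ k : Fin j, A j k • triangularSolution m A k
decreasing_by exact k.2

theorem triangularSolution_eq {M : Type*} [AddCommGroup M] [Module ℝ M] (m : ℕ → M)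
    (A : ℕ → ℕ → ℝ) (j : ℕ) :
    triangularSolution m A j =
      m j - ∑ k ∈ Finset.range j, A j k • triangularSolution m A k := by
  rw [triangularSolution, Fin.sum_univ_eq_sum_range fun k => A j k • triangularSolution m A k]

/-- Stability of null sequences under solving a triangular system with small off-diagonal rows. -/
theorem tendsto_zero_of_triangular {A : ℕ → ℕ → ℝ} {b β : ℕ → ℝ}
    (hA : ∀ j k, k < j → |A j k| ≤ (1 / 2) ^ k / 4)
    (hA0 : ∀ k, Tendsto (fun j => A j k) atTop (𝓝 0)) (hβ : Tendsto β atTop (𝓝 0))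
    (hb : ∀ j, b j = β j - ∑ k ∈ Finset.range j, A j k * b k) : Tendsto b atTop (𝓝 0) := by
  obtain ⟨B, hB⟩ : ∃ B, ∀ j, |β j| ≤ B := by
    obtain ⟨B, hB⟩ := hβ.abs.bddAbove_range
    exact ⟨B, fun j => hB ⟨j, rfl⟩⟩
  have hB0 : 0 ≤ B := (abs_nonneg _).trans (hB 0)
  have hgeo : ∀ j, ∑ k ∈ Finset.range j, ((1 : ℝ) / 2) ^ k ≤ 2 := fun j =>
    (summable_geometric_two.sum_le_tsum _ fun k _ => by positivity).trans tsum_geometric_two.le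
  -- The induction closes because `B + ∑ (2⁻ᵏ / 4) * 2B ≤ 2B`.
  have hbd : ∀ j, |b j| ≤ 2 * B := by
    intro j
    induction j using Nat.strong_induction_on with
    | _ j ih =>
      have h1 : |∑ k ∈ Finset.range j, A j k * b k| ≤
          ∑ k ∈ Finset.range j, ((1 : ℝ) / 2) ^ k * (B / 2) := by
        refine (Finset.abs_sum_le_sum_abs _ _).trans (Finset.sum_le_sum fun k hk => ?_)
        have hk := Finset.mem_range.1 hk
        rw [abs_mul]
        calc |A j k| * |b k| ≤ ((1 / 2) ^ k / 4) * (2 * B) := by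
              gcongr
              exacts [hA j k hk, ih k hk]
          _ = _ := by ring
      rw [← Finset.sum_mul] at h1
      have h2 := mul_le_mul_of_nonneg_right (hgeo j) (by positivity : 0 ≤ B / 2)
      rw [hb j]
      refine (abs_sub _ _).trans ?_
      linarith [hB j]
  -- Extended by zero, row `j` is a series over all of `ℕ`, so dominated convergence applies.
  have hlim : Tendsto (fun j => ∑' k, if k < j then A j k * b k else 0) atTop
      (𝓝 (∑' _ : ℕ, (0 : ℝ))) := by
    refine tendsto_tsum_of_dominated_convergence
      (bound := fun k => ((1 : ℝ) / 2) ^ k * (B / 2)) (summable_geometric_two.mul_right _) ?_ ?_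
    · intro k
      have : Tendsto (fun j => A j k * b k) atTop (𝓝 (0 * b k)) := (hA0 k).mul_const _
      rw [zero_mul] at this
      refine this.congr' ?_
      filter_upwards [eventually_gt_atTop k] with j hj
      rw [if_pos hj]
    · refine Eventually.of_forall fun j k => ?_
      split_ifs with hk
      · rw [Real.norm_eq_abs, abs_mul]
        calc |A j k| * |b k| ≤ ((1 / 2) ^ k / 4) * (2 * B) := by
              gcongr
              exacts [hA j k hk, hbd k]
          _ = _ := by ring
      · rw [norm_zero]; positivity
  have heq : ∀ j, b j = β j - ∑' k, if k < j then A j k * b k else 0 := by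
    intro j
    rw [tsum_eq_sum (s := Finset.range j) (fun k hk => if_neg (by simpa using hk)), hb j]
    congr 1
    exact Finset.sum_congr rfl fun k hk => (if_pos (Finset.mem_range.1 hk)).symm
  have := hβ.sub hlim
  rw [tsum_zero, sub_zero] at this
  exact this.congr fun j => (heq j).symm

/-! ### Gliding hump and biorthogonalization -/

namespace SignMeasure

variable {X : Type*} [TopologicalSpace X] [T35Space X]

/-- The ultrafilter keeps the recursion alive: almost every measure is small on all earlier bumps,
so the next one can be taken from that set. The factor 1/32 becomes 1/4 after dividing by diagonal
entries of size at least 1/8. -/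
theorem exists_bump_sequence {μ : ℕ → SignMeasure X} (h1 : ∀ n, (μ n).totalNorm = 1)
    (h0 : ∀ f : X → ℝ, Continuous f → Tendsto (fun n => (μ n).eval f) atTop (𝓝 0)) :
    ∃ (n : ℕ → ℕ) (f : ℕ → X → ℝ), StrictMono n ∧
      (∀ k, Continuous (f k) ∧ (∀ x, |f k x| ≤ 1) ∧ 1 / 8 ≤ (μ (n k)).eval (f k)) ∧
      ∀ j k, j < k → Disjoint (tsupport (f j)) (tsupport (f k)) ∧ (μ (n j)).eval (f k) = 0 ∧
        |(μ (n k)).eval (f j)| ≤ (1 / 2) ^ j / 32 := by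
  classical
  let 𝒰 : Ultrafilter ℕ := hyperfilter ℕ
  have h𝒰 : (𝒰 : Filter ℕ) ≤ atTop := Nat.hyperfilter_le_atTop
  let P : ℕ × ℕ × (X → ℝ) → Prop := fun p => Continuous p.2.2 ∧ (∀ x, |p.2.2 x| ≤ 1) ∧
    1 / 8 ≤ (μ p.2.1).eval p.2.2 ∧ ∀ᶠ m in 𝒰, (μ m).mass (tsupport p.2.2) ≤ (1 / 2) ^ p.1 / 32
  -- The first coordinate labels the smallness `2⁻ᵏ / 32`. Distinct labels make the earlier supports
  -- carry total mass at most 1/16, within the bound 1/8 needed for `C`.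
  obtain ⟨p, hp, hr⟩ := exists_seq_of_forall_good_finset
    (fun s => Set.InjOn Prod.fst (s : Set (ℕ × ℕ × (X → ℝ))) ∧ ∀ p ∈ s, P p)
    (fun p q => p.1 < q.1 ∧ p.2.1 < q.2.1 ∧ Disjoint (tsupport p.2.2) (tsupport q.2.2) ∧
      (∀ x ∈ (μ p.2.1).support, q.2.2 x = 0) ∧
      (μ q.2.1).mass (tsupport p.2.2) ≤ (1 / 2) ^ p.1 / 32) ⟨by simp, by simp⟩ (by
      rintro s ⟨hinj, hs⟩
      have hE : {m | (∀ p ∈ s, (μ m).mass (tsupport p.2.2) ≤ (1 / 2) ^ p.1 / 32) ∧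
          ∀ p ∈ s, p.2.1 < m} ∈ 𝒰 := by
        refine inter_mem ((eventually_all_finset s).2 fun p hp => (hs p hp).2.2.2)
          ((eventually_all_finset s).2 fun p _ => h𝒰 (eventually_gt_atTop p.2.1))
      have hC : IsClosed (⋃ p ∈ s, tsupport p.2.2) :=
        isClosed_biUnion_finset fun p _ => isClosed_tsupport _
      obtain ⟨n, hn, f, hfc, hf1, hfA, hfC, hf8, hfm⟩ := exists_bump h1
        (eventually_mass_compl_gt h1 h0) 𝒰 h𝒰 hC hE (fun m hm => by
          refine (mass_biUnion_le _ _ _).trans ((Finset.sum_le_sum hm.1).trans ?_)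
          rw [← Finset.sum_image (f := fun k : ℕ => ((1 : ℝ) / 2) ^ k / 32) hinj,
            ← Finset.sum_div]
          have : ∑ k ∈ s.image Prod.fst, ((1 : ℝ) / 2) ^ k ≤ 2 :=
            (summable_geometric_two.sum_le_tsum _ fun k _ => by positivity).trans
              tsum_geometric_two.le
          linarith) (s.biUnion fun p => (μ p.2.1).support)
        (η := (1 / 2) ^ (s.sup Prod.fst + 1) / 32) (by positivity)
      have hlt : ∀ p ∈ s, p.1 < s.sup Prod.fst + 1 := fun p hp =>
        Nat.lt_succ_of_le (Finset.le_sup (f := Prod.fst) hp)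
      refine ⟨(s.sup Prod.fst + 1, n, f), ⟨?_, ?_⟩, fun p hp => ⟨hlt p hp, hn.2 p hp, ?_, ?_,
        hn.1 p hp⟩⟩
      · rw [Finset.coe_insert]
        intro a ha b hb hab
        rcases ha with rfl | ha <;> rcases hb with rfl | hb
        · rfl
        · exact absurd hab (hlt b hb).ne'
        · exact absurd hab (hlt a ha).ne
        · exact hinj ha hb hab
      · intro q hq
        rcases Finset.mem_insert.1 hq with rfl | hq
        · exact ⟨hfc, hf1, hf8, hfm⟩
        · exact hs q hq
      · refine Set.disjoint_left.2 fun x hx hxf => Set.disjoint_left.1 hfC hxf ?_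
        exact Set.mem_iUnion₂.2 ⟨p, hp, hx⟩
      · exact fun x hx => hfA x (Finset.mem_biUnion.2 ⟨p, hp, hx⟩))
  have hP : ∀ k, P (p k) := fun k => by
    obtain ⟨s, hs, hk⟩ := hp k
    exact hs.2 _ hk
  have hmono : StrictMono fun k => (p k).1 :=
    strictMono_nat_of_lt_succ fun k => (hr k (k + 1) k.lt_succ_self).1
  have hk : ∀ k, k ≤ (p k).1 := fun k => hmono.le_apply
  refine ⟨fun k => (p k).2.1, fun k => (p k).2.2, fun j k hjk => (hr j k hjk).2.1,
    fun k => ⟨(hP k).1, (hP k).2.1, (hP k).2.2.1⟩, fun j k hjk => ?_⟩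
  obtain ⟨-, -, h3, h4, h5⟩ := hr j k hjk
  refine ⟨h3, eval_eq_zero _ h4, ?_⟩
  refine (abs_eval_le_mass _ (hP j).2.1
    fun x hx => image_eq_zero_of_notMem_tsupport hx).trans (h5.trans ?_)
  gcongr ?_ / 32
  exact pow_le_pow_of_le_one (by norm_num) (by norm_num) (hk j)

/-- The Josefson–Nissenzweig property yields a weakly null sequence of sign-measures that is
biorthogonal to a bounded sequence of disjointly supported continuous functions. -/
theorem exists_biorthogonal (h : HasJNP X) :
    ∃ (ν : ℕ → SignMeasure X) (g : ℕ → X → ℝ),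
      (∀ f : X → ℝ, Continuous f → Tendsto (fun n => (ν n).eval f) atTop (𝓝 0)) ∧
      (∀ k, Continuous (g k)) ∧ (∀ k x, |g k x| ≤ 8) ∧
      (∀ j k x, j ≠ k → g j x ≠ 0 → g k x = 0) ∧
      ∀ j k, (ν j).eval (g k) = if j = k then 1 else 0 := by
  obtain ⟨μ, h1, h0⟩ := h
  obtain ⟨n, f, hn, hf, hjk⟩ := exists_bump_sequence h1 h0
  let d : ℕ → ℝ := fun k => (μ (n k)).eval (f k)
  have hd : ∀ k, 1 / 8 ≤ d k := fun k => (hf k).2.2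
  have hd0 : ∀ k, 0 < d k := fun k => lt_of_lt_of_le (by norm_num) (hd k)
  have hdinv : ∀ k, (d k)⁻¹ ≤ 8 := fun k => by
    rw [inv_le_comm₀ (hd0 k) (by norm_num)]; linarith [hd k]
  let g : ℕ → X → ℝ := fun k => (d k)⁻¹ • f k
  have hgc : ∀ k, Continuous (g k) := fun k => (hf k).1.const_smul _
  let A : ℕ → ℕ → ℝ := fun j k => (μ (n j)).eval (g k)
  have hAeq : ∀ j k, A j k = (d k)⁻¹ * (μ (n j)).eval (f k) := fun j k => eval_smul_right _ _ _
  have hA1 : ∀ j, A j j = 1 := fun j => by rw [hAeq]; exact inv_mul_cancel₀ (hd0 j).ne'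
  have hAz : ∀ j k, j < k → A j k = 0 := fun j k h => by
    rw [hAeq, (hjk j k h).2.1, mul_zero]
  have hA : ∀ j k, k < j → |A j k| ≤ (1 / 2) ^ k / 4 := fun j k h => by
    rw [hAeq, abs_mul, abs_of_pos (inv_pos.2 (hd0 k))]
    calc _ ≤ 8 * (((1 : ℝ) / 2) ^ k / 32) := by
          gcongr
          exacts [hdinv k, (hjk k j h).2.2]
      _ = _ := by ring
  -- The matrix `A` is lower triangular with unit diagonal, so forward substitution turns it into
  -- the identity.
  let ν : ℕ → SignMeasure X := triangularSolution (fun j => μ (n j)) A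
  have hν : ∀ f j, (ν j).eval f =
      (μ (n j)).eval f - ∑ k ∈ Finset.range j, A j k * (ν k).eval f := fun f j => by
    simp only [ν]
    rw [triangularSolution_eq, eval_sub_left, eval_sum_left]
    simp only [eval_smul_left]
  have hμ0 : ∀ f : X → ℝ, Continuous f → Tendsto (fun j => (μ (n j)).eval f) atTop (𝓝 0) :=
    fun f hf => (h0 f hf).comp hn.tendsto_atTop
  refine ⟨ν, g, fun f hf => ?_, hgc, fun k x => ?_, fun j k x hne hj => ?_, fun j k => ?_⟩
  · exact tendsto_zero_of_triangular hA (fun k => hμ0 _ (hgc k)) (hμ0 f hf) (hν f)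
  · simp only [g, Pi.smul_apply, smul_eq_mul, abs_mul, abs_of_pos (inv_pos.2 (hd0 k))]
    calc _ ≤ 8 * (1 : ℝ) := by
          gcongr
          exacts [hdinv k, (hf k).2.1 x]
      _ = 8 := mul_one _
  · have hd : Disjoint (tsupport (f j)) (tsupport (f k)) := by
      rcases lt_or_gt_of_ne hne with h | h
      · exact (hjk j k h).1
      · exact (hjk k j h).1.symm
    have hj' : f j x ≠ 0 := fun h => hj (by simp [g, h])
    have : f k x = 0 := image_eq_zero_of_notMem_tsupport
      (Set.disjoint_left.1 hd (subset_tsupport _ hj'))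
    simp [g, this]
  · induction j using Nat.strong_induction_on with
    | _ j ih =>
      rw [hν, Finset.sum_congr rfl fun i hi => by rw [ih i (Finset.mem_range.1 hi)]]
      simp only [mul_ite, mul_one, mul_zero, Finset.sum_ite_eq', Finset.mem_range]
      change A j k - _ = _
      rcases lt_trichotomy j k with h | rfl | h
      · rw [hAz j k h, if_neg h.ne, if_neg h.not_gt, sub_zero]
      · rw [hA1, if_pos rfl, if_neg (lt_irrefl _), sub_zero]
      · rw [if_pos h, if_neg h.ne', sub_self]

end SignMeasure

/-! ### Complemented copies of `c0` -/

theorem Cp.continuous_eval {X : Type*} [TopologicalSpace X] (x : X) :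
    Continuous fun f : Cp X => (f : X → ℝ) x :=
  (continuous_apply x).comp continuous_subtype_val

/-- A sign-measure as a continuous linear functional on `C_p(X)`. -/
def SignMeasure.toCLM {X : Type*} [TopologicalSpace X] (μ : SignMeasure X) : Cp X →L[ℝ] ℝ where
  toFun f := μ.eval f
  map_add' f g := μ.eval_add_right f g
  map_smul' c f := μ.eval_smul_right c f
  cont := continuous_finsetSum _ fun x _ => continuous_const.mul (Cp.continuous_eval x)

/-- A weakly null sequence of sign-measures as an operator from `C_p(X)` to `c₀`. -/
def Cp.toC0 {X : Type*} [TopologicalSpace X] (ν : ℕ → SignMeasure X)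
    (h : ∀ f : X → ℝ, Continuous f → Tendsto (fun n => (ν n).eval f) atTop (𝓝 0)) :
    Cp X →L[ℝ] c0 :=
  (ContinuousLinearMap.pi fun n => (ν n).toCLM).codRestrict c0 fun f => h f f.2

/-- The synthesis operator of a bounded disjointly supported sequence of continuous functions,
where `κ x` is the only index `k` at which `g k x` may be nonzero. -/
def c0.toCp {X : Type*} [TopologicalSpace X] (g : ℕ → X → ℝ) (κ : X → ℕ)
    (h : ∀ x ∈ c0, Continuous fun t => x (κ t) * g (κ t) t) : c0 →L[ℝ] Cp X where
  toFun x := ⟨fun t => (x : ℕ → ℝ) (κ t) * g (κ t) t, h x x.2⟩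
  map_add' _ _ := Subtype.ext (funext fun _ => add_mul _ _ _)
  map_smul' _ _ := Subtype.ext (funext fun _ => mul_assoc _ _ _)
  cont := Continuous.subtype_mk (continuous_pi fun t =>
    ((continuous_apply (κ t)).comp continuous_subtype_val).mul continuous_const) _

theorem sum_range_disjoint {X : Type*} {g : ℕ → X → ℝ} {κ : X → ℕ}
    (hκ : ∀ t k, k ≠ κ t → g k t = 0) (x : ℕ → ℝ) (N : ℕ) (t : X) :
    ∑ k ∈ Finset.range N, x k * g k t = if κ t < N then x (κ t) * g (κ t) t else 0 := by
  split_ifs with h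
  · exact Finset.sum_eq_single_of_mem _ (Finset.mem_range.2 h)
      fun k _ hk => by rw [hκ t k hk, mul_zero]
  · refine Finset.sum_eq_zero fun k hk => ?_
    rw [hκ t k (fun e => h (e ▸ Finset.mem_range.1 hk)), mul_zero]

/-- The partial sums converge uniformly: at most one term is nonzero at each point, so a tail is
bounded by `C * sup |x k|`. -/
theorem continuous_disjoint_series {X : Type*} [TopologicalSpace X] {g : ℕ → X → ℝ} {κ : X → ℕ}
    (hg : ∀ k, Continuous (g k)) {C : ℝ} (hC : ∀ k x, |g k x| ≤ C)
    (hκ : ∀ t k, k ≠ κ t → g k t = 0) {x : ℕ → ℝ} (hx : Tendsto x atTop (𝓝 0)) :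
    Continuous fun t => x (κ t) * g (κ t) t := by
  rcases isEmpty_or_nonempty X with hX | ⟨⟨t₀⟩⟩
  · exact continuous_of_const fun t => isEmptyElim t
  have hC0 : 0 ≤ C := (abs_nonneg _).trans (hC 0 t₀)
  have hlim : TendstoUniformly (fun N t => ∑ k ∈ Finset.range N, x k * g k t)
      (fun t => x (κ t) * g (κ t) t) atTop := by
    rw [Metric.tendstoUniformly_iff]
    intro ε hε
    have hev : ∀ᶠ k in atTop, |x k| < ε / (C + 1) := by
      have := hx.abs
      rw [abs_zero] at this
      exact this.eventually (gt_mem_nhds (by positivity))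
    obtain ⟨N, hN⟩ := eventually_atTop.1 hev
    filter_upwards [eventually_ge_atTop N] with n hn t
    rw [sum_range_disjoint hκ]
    split_ifs with h
    · simpa using hε
    · rw [Real.dist_eq, sub_zero, abs_mul]
      calc _ ≤ |x (κ t)| * C := by gcongr; exact hC _ _
        _ ≤ |x (κ t)| * (C + 1) := by gcongr; linarith
        _ < ε := (lt_div_iff₀ (by positivity)).1 (hN _ (hn.trans (not_lt.1 h)))
  exact hlim.continuous (Frequently.of_forall fun N =>
    continuous_finsetSum _ fun k _ => continuous_const.mul (hg k))

/-- The range of a continuous linear map with a continuous left inverse is complemented and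
isomorphic to the domain. -/
theorem ContinuousLinearMap.exists_complemented_equiv_of_leftInverse {E F : Type*}
    [AddCommGroup E] [Module ℝ E] [TopologicalSpace E] [AddCommGroup F] [Module ℝ F]
    [TopologicalSpace F] (S : F →L[ℝ] E) (T : E →L[ℝ] F) (h : Function.LeftInverse T S) :
    ∃ M : Submodule ℝ E, M.ClosedComplemented ∧ Nonempty (M ≃L[ℝ] F) := by
  refine ⟨S.range, S.closedComplemented_range_of_leftInverse T h,
    ⟨(ContinuousLinearEquiv.equivOfInverse (S.codRestrict S.range fun x => ⟨x, rfl⟩)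
      (T.comp S.range.subtypeL) (fun x => h x) ?_).symm⟩⟩
  rintro ⟨_, x, rfl⟩
  exact Subtype.ext (congrArg S (h x))

theorem HasJNP.exists_complemented_c0 {X : Type*} [TopologicalSpace X] [T35Space X]
    (h : HasJNP X) :
    ∃ S : Submodule ℝ (Cp X), S.ClosedComplemented ∧ Nonempty (S ≃L[ℝ] c0) := by
  obtain ⟨ν, g, hν, hg, hg8, hdisj, hbi⟩ := SignMeasure.exists_biorthogonal h
  have : ∀ t, ∃ i, ∀ k, k ≠ i → g k t = 0 := fun t => by
    by_cases h : ∃ i, g i t ≠ 0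
    · obtain ⟨i, hi⟩ := h
      exact ⟨i, fun k hk => hdisj i k t hk.symm hi⟩
    · push Not at h
      exact ⟨0, fun k _ => h k⟩
  choose κ hκ using this
  let S := c0.toCp g κ fun x hx => continuous_disjoint_series hg hg8 hκ hx
  refine S.exists_complemented_equiv_of_leftInverse (Cp.toC0 ν hν) fun x => Subtype.ext ?_
  funext j
  change (ν j).eval (fun t => (x : ℕ → ℝ) (κ t) * g (κ t) t) = (x : ℕ → ℝ) j
  -- On the finite support of `ν j` the series stops before `N`, so biorthogonality applies to a
  -- finite sum that still contains the index `j`.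
  let N := max (j + 1) ((ν j).support.sup κ + 1)
  rw [SignMeasure.eval_congr (g := fun t => ∑ k ∈ Finset.range N, ((x : ℕ → ℝ) k • g k) t),
    SignMeasure.eval_sum_right]
  · simp only [SignMeasure.eval_smul_right, hbi, mul_ite, mul_one, mul_zero]
    rw [Finset.sum_ite_eq, if_pos (Finset.mem_range.2 (lt_max_of_lt_left j.lt_succ_self))]
  · intro t ht
    have hlt : κ t < N := lt_max_of_lt_right (Nat.lt_succ_of_le (Finset.le_sup ht))
    exact ((sum_range_disjoint hκ x N t).trans (if_pos hlt)).symm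

theorem Submodule.ClosedComplemented.exists_quotient_equiv {E F : Type*}
    [AddCommGroup E] [Module ℝ E] [TopologicalSpace E] [IsTopologicalAddGroup E] [T2Space E]
    [AddCommGroup F] [Module ℝ F] [TopologicalSpace F] {S : Submodule ℝ E}
    (hS : S.ClosedComplemented) (e : S ≃L[ℝ] F) :
    ∃ Z : Submodule ℝ E, IsClosed (Z : Set E) ∧ Nonempty ((E ⧸ Z) ≃L[ℝ] F) := by
  obtain ⟨q, hq⟩ := hS.exists_isTopCompl
  exact ⟨q, hq.isClosed', ⟨(Submodule.quotientEquivOfIsTopCompl q S hq.symm).trans e⟩⟩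

instance c0.metrizableSpace : TopologicalSpace.MetrizableSpace c0 :=
  IsEmbedding.subtypeVal.metrizableSpace

theorem c0.single_mem (n : ℕ) (a : ℝ) : Pi.single n a ∈ c0 :=
  tendsto_const_nhds.congr' <| by
    filter_upwards [eventually_gt_atTop n] with k hk
    rw [Pi.single_eq_of_ne hk.ne']

theorem c0.not_finiteDimensional : ¬ FiniteDimensional ℝ c0 := by
  intro h
  have hli : LinearIndependent ℝ fun n : ℕ => (⟨Pi.single n 1, c0.single_mem n 1⟩ : c0) := by
    refine LinearIndependent.of_comp c0.subtype ?_
    exact Pi.linearIndependent_single_one ℕ ℝ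
  have := hli.finite
  exact not_finite ℕ

/-! ### Metrizable subspaces and the dual of `Cp X` -/

/-- A metrizable linear subspace of `C_p(X)` is separable. -/
theorem Cp.separableSpace_of_metrizableSpace {X : Type*} [TopologicalSpace X]
    (S : Submodule ℝ (Cp X)) [TopologicalSpace.MetrizableSpace S] :
    TopologicalSpace.SeparableSpace S := by
  let ι : S →+ (X → ℝ) := (Cp X).subtype.toAddMonoidHom.comp S.subtype.toAddMonoidHom
  have hι : IsInducing ι := IsInducing.subtypeVal.comp IsInducing.subtypeVal
  obtain ⟨u, hu⟩ := (𝓝 (0 : S)).exists_antitone_basis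
  have key : ∀ n, ∃ F : Set X, F.Finite ∧ ∃ t : X → Set ℝ, (∀ x, t x ∈ 𝓝 0) ∧
      ι ⁻¹' (F.pi t) ⊆ u n := by
    intro n
    have h : u n ∈ 𝓝 (0 : S) := hu.1.mem_of_mem trivial
    rw [hι.nhds_eq_comap, map_zero, nhds_pi] at h
    obtain ⟨v, hv, hvu⟩ := h
    obtain ⟨F, hF, t, ht, htv⟩ := Filter.mem_pi.1 hv
    exact ⟨F, hF, t, ht, (Set.preimage_mono htv).trans hvu⟩
  choose F hF t ht htu using key
  have hA : (⋃ n, F n).Countable := Set.countable_iUnion fun n => (hF n).countable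
  have := hA.to_subtype
  -- A countable base at 0 involves only countably many points. Restriction to them still induces
  -- the topology of `S`, from a second countable product.
  let r : S →+ ((⋃ n, F n : Set X) → ℝ) :=
    { toFun := fun s x => ι s x
      map_zero' := rfl
      map_add' := fun _ _ => rfl }
  have hrc : Continuous r := continuous_pi fun x => (continuous_apply x.1).comp hι.continuous
  have hr : IsInducing r := by
    rw [IsTopologicalAddGroup.isInducing_iff_nhds_zero]
    refine le_antisymm ?_ ?_
    · rw [← map_le_iff_le_comap]
      have := hrc.tendsto 0
      rwa [map_zero] at this
    · rw [hu.1.ge_iff]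
      intro n _
      refine ⟨{y | ∀ x : (⋃ n, F n : Set X), x.1 ∈ F n → y x ∈ t n x}, ?_, fun s hs => ?_⟩
      · have hfin : {x : (⋃ n, F n : Set X) | x.1 ∈ F n}.Finite :=
          (hF n).preimage Subtype.val_injective.injOn
        exact set_pi_mem_nhds hfin fun x _ => ht n x
      · exact htu n fun x hx => hs ⟨x, Set.mem_iUnion.2 ⟨n, hx⟩⟩ hx
  have := hr.secondCountableTopology
  infer_instance

/-- Continuous linear functionals on `C_p(X)` are finitely supported sign-measures. -/
theorem Cp.exists_signMeasure_eq {X : Type*} [TopologicalSpace X] (φ : Cp X →L[ℝ] ℝ) :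
    ∃ μ : SignMeasure X, ∀ f : Cp X, φ f = μ.eval f := by
  have hnhds : φ ⁻¹' Metric.ball 0 1 ∈ 𝓝 (0 : Cp X) := by
    refine φ.continuous.continuousAt.preimage_mem_nhds ?_
    rw [map_zero]
    exact Metric.ball_mem_nhds _ one_pos
  rw [IsInducing.subtypeVal.nhds_eq_comap, ZeroMemClass.coe_zero, nhds_pi] at hnhds
  obtain ⟨v, hv, hvφ⟩ := hnhds
  obtain ⟨F, hF, t, ht, htv⟩ := Filter.mem_pi.1 hv
  have := hF.fintype
  let L : F → Cp X →ₗ[ℝ] ℝ := fun x => (LinearMap.proj x.1).comp (Cp X).subtype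
  -- If `f` vanishes on `F`, all its multiples lie in the neighbourhood where `|φ| < 1`, so `φ f =
  -- 0`.
  have hker : ⨅ x, LinearMap.ker (L x) ≤ LinearMap.ker φ.toLinearMap := by
    intro f hf
    have hf0 : ∀ x ∈ F, (f : X → ℝ) x = 0 := fun x hx => (Submodule.mem_iInf _).1 hf ⟨x, hx⟩
    by_contra hne
    have hne : φ f ≠ 0 := hne
    have hmem : (φ f)⁻¹ • f ∈ φ ⁻¹' Metric.ball 0 1 := by
      refine hvφ (htv fun x hx => ?_)
      have : ((φ f)⁻¹ • (f : X → ℝ)) x = 0 := by simp [hf0 x hx]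
      change ((φ f)⁻¹ • (f : X → ℝ)) x ∈ t x
      rw [this]
      exact mem_of_mem_nhds (ht x)
    simp [inv_mul_cancel₀ hne] at hmem
  obtain ⟨c, hc⟩ := (Submodule.mem_span_range_iff_exists_fun ℝ).1 (mem_span_of_iInf_ker_le_ker hker)
  refine ⟨∑ x : F, Finsupp.single x.1 (c x), fun f => ?_⟩
  rw [SignMeasure.eval_sum_left]
  have := LinearMap.congr_fun hc f
  simpa [SignMeasure.eval_eq_linearCombination, L] using this.symm

/-! ### From a `c0` quotient to the JNP -/

/-- A weakly null sequence of sign-measures whose norms do not tend to zero gives the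
Josefson–Nissenzweig property. -/
theorem HasJNP.of_frequently_le {X : Type*} [TopologicalSpace X] {μ : ℕ → SignMeasure X}
    (h0 : ∀ f : X → ℝ, Continuous f → Tendsto (fun n => (μ n).eval f) atTop (𝓝 0))
    {c : ℝ} (hc : 0 < c) (h : ∃ᶠ n in atTop, c ≤ (μ n).totalNorm) : HasJNP X := by
  obtain ⟨n, hn, hcn⟩ := extraction_of_frequently_atTop h
  have hne : ∀ k, μ (n k) ≠ 0 := fun k h => by
    have := hcn k
    rw [h] at this
    exact absurd this (by simpa [SignMeasure.totalNorm] using hc)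
  refine ⟨fun k => (μ (n k)).totalNorm⁻¹ • μ (n k),
    fun k => SignMeasure.totalNorm_inv_smul (hne k), fun f hf => ?_⟩
  have hlim : Tendsto (fun k => c⁻¹ * |(μ (n k)).eval f|) atTop (𝓝 0) := by
    simpa using (((h0 f hf).comp hn.tendsto_atTop).abs).const_mul c⁻¹
  refine squeeze_zero_norm (fun k => ?_) hlim
  rw [SignMeasure.eval_smul_left, Real.norm_eq_abs, abs_mul,
    abs_of_pos (inv_pos.2 (SignMeasure.totalNorm_pos (hne k)))]
  gcongr
  exact hcn k

/-- No continuous function is eventually unbounded on the supports of a weakly null sequence of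
sign-measures. -/
theorem SignMeasure.not_forall_eventually_exists_support_gt {X : Type*} [TopologicalSpace X]
    [T35Space X] {μ : ℕ → SignMeasure X}
    (h0 : ∀ f : X → ℝ, Continuous f → Tendsto (fun n => (μ n).eval f) atTop (𝓝 0))
    {f : X → ℝ} (hf : Continuous f) :
    ¬ ∀ ρ : ℝ, ∀ᶠ n in atTop, ∃ x ∈ (μ n).support, ρ < |f x| := by
  classical
  intro hunb
  -- Triples (level, index, bump): the bump isolates one support point with `|f|` above the level,
  -- and each level dominates `|f|` on all earlier supports.
  obtain ⟨p, hp, hr⟩ := exists_seq_of_forall_finset_exists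
    (fun p : ℝ × ℕ × (X → ℝ) => Continuous p.2.2 ∧ (∀ x, |f x| ≤ p.1 → p.2.2 x = 0) ∧
      (μ p.2.1).eval p.2.2 ≠ 0)
    (fun p q => p.1 + 1 ≤ q.1 ∧ p.2.1 < q.2.1 ∧ ∀ x ∈ (μ p.2.1).support, |f x| ≤ q.1) (by
      intro s _
      obtain ⟨ρ, hρ⟩ := Finset.exists_le (s.image (fun p => p.1 + 1) ∪
        s.biUnion fun p => (μ p.2.1).support.image fun x => |f x|)
      obtain ⟨n, ⟨x, hx, hxρ⟩, hn⟩ := ((hunb ρ).and ((eventually_all_finset s).2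
        fun p _ => eventually_gt_atTop p.2.1)).exists
      obtain ⟨τ, hτ, -, hτx, hτW⟩ := exists_continuous_interpolation {x}
        (W := {y | ρ < |f y|} ∩ (((μ n).support.erase x : Finset X) : Set X)ᶜ)
        ((isOpen_lt continuous_const hf.abs).inter (Finset.finite_toSet _).isClosed.isOpen_compl)
        (by simpa using hxρ) (fun _ => 1) (by simp)
      have hτ0 : ∀ y, y ∉ {y | ρ < |f y|} ∩ (((μ n).support.erase x : Finset X) : Set X)ᶜ →
          τ y = 0 := fun y hy => image_eq_zero_of_notMem_tsupport fun h => hy (hτW h)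
      refine ⟨(ρ, n, τ), ⟨hτ, fun y hy => hτ0 y fun h => not_lt.2 hy h.1, ?_⟩,
        fun p hp => ⟨?_, hn p hp, fun y hy => ?_⟩⟩
      · have : (μ n).eval τ = μ n x := by
          rw [SignMeasure.eval, Finset.sum_eq_single_of_mem x hx, hτx x (by simp), mul_one]
          intro y hy hyx
          rw [hτ0 y fun h => h.2 (Finset.mem_erase.2 ⟨hyx, hy⟩), mul_zero]
        rw [this]
        exact Finsupp.mem_support_iff.1 hx
      · exact hρ _ (Finset.mem_union_left _ (Finset.mem_image_of_mem _ hp))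
      · exact hρ _ (Finset.mem_union_right _ (Finset.mem_biUnion.2
          ⟨p, hp, Finset.mem_image_of_mem (fun x => |f x|) hy⟩)))
  let ρ : ℕ → ℝ := fun k => (p k).1
  let n : ℕ → ℕ := fun k => (p k).2.1
  let τ : ℕ → X → ℝ := fun k => (p k).2.2
  have hn : StrictMono n := fun j k hjk => (hr j k hjk).2.1
  have hτ0 : ∀ k x, |f x| ≤ ρ k → τ k x = 0 := fun k => (hp k).2.1
  have hρ : ∀ k, ρ 0 + k ≤ ρ k := fun k => by
    induction k with
    | zero => simp
    | succ k ih =>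
      have : ρ k + 1 ≤ ρ (k + 1) := (hr k (k + 1) k.lt_succ_self).1
      push_cast
      linarith
  have hρsupp : ∀ j k, j < k → ∀ x ∈ (μ (n j)).support, |f x| ≤ ρ k :=
    fun j k hjk => (hr j k hjk).2.2
  let A : ℕ → ℕ → ℝ := fun j k => (μ (n j)).eval (τ k)
  have hA : ∀ j, A j j ≠ 0 := fun j => (hp j).2.2
  -- These coefficients force `μ (n j) ψ = 1` for all `j`, against weak nullity.
  let c : ℕ → ℝ := triangularSolution (fun j => (A j j)⁻¹) fun j k => (A j j)⁻¹ * A j k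
  have hc : ∀ j, ∑ k ∈ Finset.range (j + 1), c k * A j k = 1 := fun j => by
    have h : c j = (A j j)⁻¹ - ∑ k ∈ Finset.range j, ((A j j)⁻¹ * A j k) • c k :=
      triangularSolution_eq _ _ j
    rw [Finset.sum_range_succ, h, sub_mul, inv_mul_cancel₀ (hA j), Finset.sum_mul,
      add_sub_left_comm, ← Finset.sum_sub_distrib, Finset.sum_eq_zero, add_zero]
    intro k _
    rw [smul_eq_mul]
    field_simp [hA j]
    ring
  let ψ : X → ℝ := fun x => ∑' k, c k * τ k x
  -- The levels tend to infinity while `f` is locally bounded, so the series is locally finite.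
  have hψ : Continuous ψ := by
    refine continuous_iff_continuousAt.2 fun x => ?_
    obtain ⟨N, hN⟩ := exists_nat_gt (|f x| - ρ 0)
    have hev : ∀ᶠ y in 𝓝 x, |f y| < ρ 0 + N :=
      hf.abs.continuousAt.eventually (gt_mem_nhds (by linarith))
    have hcont : Continuous fun y => ∑ k ∈ Finset.range N, c k * τ k y :=
      continuous_finsetSum _ fun k _ => continuous_const.mul (hp k).1
    refine hcont.continuousAt.congr ?_
    filter_upwards [hev] with y hy
    refine (tsum_eq_sum fun k hk => ?_).symm
    have hkN : (N : ℝ) ≤ k := by exact_mod_cast not_lt.1 fun h => hk (Finset.mem_range.2 h)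
    rw [hτ0 k y (by linarith [hρ k]), mul_zero]
  have hone : ∀ j, (μ (n j)).eval ψ = 1 := fun j => by
    rw [← hc j, SignMeasure.eval_congr (g := fun x => ∑ k ∈ Finset.range (j + 1), (c k • τ k) x),
      SignMeasure.eval_sum_right]
    · simp only [SignMeasure.eval_smul_right, A]
    · intro x hx
      refine tsum_eq_sum fun k hk => ?_
      have hjk : j < k := not_le.1 fun h => hk (Finset.mem_range.2 (Nat.lt_succ_of_le h))
      rw [hτ0 k x (hρsupp j k hjk x hx), mul_zero]
  have hlim := (h0 ψ hψ).comp hn.tendsto_atTop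
  exact zero_ne_one (tendsto_nhds_unique hlim (tendsto_const_nhds.congr fun j => (hone j).symm))

theorem HasJNP.of_quotient_c0 {X : Type*} [TopologicalSpace X] [T35Space X]
    {Z : Submodule ℝ (Cp X)} (e : (Cp X ⧸ Z) ≃L[ℝ] c0) : HasJNP X := by
  let φ : ℕ → Cp X →L[ℝ] ℝ := fun n =>
    (ContinuousLinearMap.proj n).comp (c0.subtypeL.comp (e.toContinuousLinearMap.comp Z.mkQL))
  have hφ : ∀ n f, φ n f = (e (Z.mkQ f) : ℕ → ℝ) n := fun n f => rfl
  choose μ hμ using fun n => Cp.exists_signMeasure_eq (φ n)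
  have h0 : ∀ f : X → ℝ, Continuous f → Tendsto (fun n => (μ n).eval f) atTop (𝓝 0) :=
    fun f hf => (e (Z.mkQ ⟨f, hf⟩)).2.congr fun n => hμ n ⟨f, hf⟩
  have hsurj : ∀ x ∈ c0, ∃ f : X → ℝ, Continuous f ∧ ∀ n, (μ n).eval f = x n := by
    intro x hx
    obtain ⟨f, hf⟩ := Z.mkQ_surjective (e.symm ⟨x, hx⟩)
    refine ⟨f, f.2, fun n => ?_⟩
    rw [← hμ, hφ, hf, e.apply_symm_apply]
  by_contra hJ
  have hev : ∀ c : ℝ, 0 < c → ∀ᶠ n in atTop, (μ n).totalNorm < c := fun c hc => by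
    have : ¬ ∃ᶠ n in atTop, c ≤ (μ n).totalNorm := fun h => hJ (HasJNP.of_frequently_le h0 hc h)
    simpa [not_frequently] using this
  have hpos : ∀ n, 0 < (μ n).totalNorm := fun n => by
    refine SignMeasure.totalNorm_pos fun h => ?_
    obtain ⟨f, -, hf⟩ := hsurj _ (c0.single_mem n 1)
    have := hf n
    rw [h, Pi.single_eq_same] at this
    simp [SignMeasure.eval] at this
  have ht : Tendsto (fun n => (μ n).totalNorm) atTop (𝓝 0) :=
    tendsto_order.2 ⟨fun a ha => Eventually.of_forall fun n => ha.trans (hpos n), hev⟩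
  -- The square root tends to 0 yet dominates every multiple of the norm, so an `f` with these
  -- values cannot stay below any fixed `ρ` on the supports.
  have hsqrt : Tendsto (fun n => √(μ n).totalNorm) atTop (𝓝 0) := by
    simpa using ht.sqrt
  obtain ⟨f, hf, hfs⟩ := hsurj _ hsqrt
  refine SignMeasure.not_forall_eventually_exists_support_gt h0 hf fun ρ => ?_
  have hlim : Tendsto (fun n => ρ * √(μ n).totalNorm) atTop (𝓝 0) := by
    simpa using hsqrt.const_mul ρ
  filter_upwards [hlim.eventually (gt_mem_nhds one_pos)] with n hn
  by_contra! hcon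
  have h1 := (μ n).abs_eval_le hcon
  have hs := Real.sqrt_pos.2 (hpos n)
  rw [hfs n, abs_of_pos hs] at h1
  have h2 := Real.mul_self_sqrt (hpos n).le
  have h3 := mul_lt_mul_of_pos_right hn hs
  rw [mul_assoc, h2] at h3
  linarith

/-! ### Annihilating functionals and Polishable quotients -/

theorem exists_clm_separating {E : Type*} [AddCommGroup E] [Module ℝ E] [TopologicalSpace E]
    [IsTopologicalAddGroup E] [ContinuousSMul ℝ E] [LocallyConvexSpace ℝ E] {Z : Submodule ℝ E}
    (hZ : IsClosed (Z : Set E)) {x : E} (hx : x ∉ Z) :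
    ∃ φ : E →L[ℝ] ℝ, (∀ z ∈ Z, φ z = 0) ∧ φ x ≠ 0 := by
  obtain ⟨φ, u, hφx, hφ⟩ := geometric_hahn_banach_point_closed Z.convex hZ hx
  have hu : u < 0 := by simpa using hφ 0 Z.zero_mem
  refine ⟨φ, fun z hz => ?_, (hφx.trans hu).ne⟩
  -- A functional bounded below on a subspace vanishes there: rescaling `z` would attain the
  -- excluded value `u`.
  by_contra hne
  have := hφ _ (Z.smul_mem (u / φ z) hz)
  rw [map_smul, smul_eq_mul, div_mul_cancel₀ _ hne] at this
  exact lt_irrefl _ this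

/-- Finitely many vectors separating `V` embed it in `ℝⁿ`, and the quotient embeds in the dual of
`V`. -/
theorem LinearMap.finiteDimensional_quotient_ker_flip {V E : Type*} [AddCommGroup V] [Module ℝ V]
    [AddCommGroup E] [Module ℝ E] (B : V →ₗ[ℝ] E →ₗ[ℝ] ℝ) {n : ℕ} (f : Fin n → E)
    (h : ∀ v, (∀ i, B v (f i) = 0) → v = 0) : FiniteDimensional ℝ (E ⧸ LinearMap.ker B.flip) := by
  let r : V →ₗ[ℝ] (Fin n → ℝ) := LinearMap.pi fun i => B.flip (f i)
  have hr : LinearMap.ker r = ⊥ := LinearMap.ker_eq_bot'.2 fun v hv => h v (congrFun hv)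
  have : FiniteDimensional ℝ V := FiniteDimensional.of_injective r (LinearMap.ker_eq_bot.1 hr)
  exact FiniteDimensional.of_injective ((LinearMap.ker B.flip).liftQ B.flip le_rfl)
    (LinearMap.ker_eq_bot.1 (Submodule.ker_liftQ_eq_bot _ _ _ le_rfl))

/-- Otherwise the `f i` separate the annihilator of `Z`, which is then finite-dimensional; by
Hahn–Banach its common kernel is `Z`, so `E ⧸ Z` would be too. -/
theorem exists_clm_ne_zero_of_not_finiteDimensional {E : Type*} [AddCommGroup E] [Module ℝ E]
    [TopologicalSpace E] [IsTopologicalAddGroup E] [ContinuousSMul ℝ E] [LocallyConvexSpace ℝ E]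
    {Z : Submodule ℝ E} (hZ : IsClosed (Z : Set E)) (hinf : ¬ FiniteDimensional ℝ (E ⧸ Z))
    {n : ℕ} (f : Fin n → E) :
    ∃ φ : E →L[ℝ] ℝ, φ ≠ 0 ∧ (∀ z ∈ Z, φ z = 0) ∧ ∀ i, φ (f i) = 0 := by
  by_contra! hcon
  let W : Submodule ℝ (E →ₗ[ℝ] ℝ) :=
    { carrier := {φ | Continuous φ ∧ ∀ z ∈ Z, φ z = 0}
      add_mem' := fun ha hb => ⟨ha.1.add hb.1, fun z hz => by simp [ha.2 z hz, hb.2 z hz]⟩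
      zero_mem' := ⟨continuous_const, fun _ _ => rfl⟩
      smul_mem' := fun c _ ha => ⟨ha.1.const_smul c, fun z hz => by simp [ha.2 z hz]⟩ }
  have hfin := LinearMap.finiteDimensional_quotient_ker_flip W.subtype f fun (φ : W) hφ => by
    by_contra hne
    obtain ⟨i, hi⟩ := hcon ⟨φ.1, φ.2.1⟩
      (fun h => hne (Subtype.ext (congrArg ContinuousLinearMap.toLinearMap h))) φ.2.2
    exact hi (hφ i)
  have hD : LinearMap.ker W.subtype.flip = Z := by
    ext x
    refine ⟨fun hx => ?_, fun hx => LinearMap.ext fun φ : W => φ.2.2 x hx⟩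
    by_contra hxZ
    obtain ⟨φ, hφ, hne⟩ := exists_clm_separating hZ hxZ
    exact hne (LinearMap.congr_fun hx (⟨φ.toLinearMap, φ.continuous, hφ⟩ : W))
  rw [hD] at hfin
  exact hinf hfin

/-- On an infinite-dimensional quotient of `C_p(X)` there are normalized sign-measures eventually
vanishing on each term of a given sequence. -/
theorem Cp.exists_normalized_annihilating {X : Type*} [TopologicalSpace X]
    {Z : Submodule ℝ (Cp X)} (hZ : IsClosed (Z : Set (Cp X)))
    (hinf : ¬ FiniteDimensional ℝ (Cp X ⧸ Z)) (f : ℕ → Cp X) :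
    ∃ μ : ℕ → SignMeasure X, (∀ n, (μ n).totalNorm = 1) ∧
      (∀ n, ∀ z ∈ Z, (μ n).eval z = 0) ∧ ∀ i n, i < n → (μ n).eval (f i) = 0 := by
  have key : ∀ n, ∃ μ : SignMeasure X, μ.totalNorm = 1 ∧ (∀ z ∈ Z, μ.eval z = 0) ∧
      ∀ i < n, μ.eval (f i) = 0 := by
    intro n
    obtain ⟨φ, hφ, hφZ, hφf⟩ :=
      exists_clm_ne_zero_of_not_finiteDimensional hZ hinf fun i : Fin n => f i
    obtain ⟨μ, hμ⟩ := Cp.exists_signMeasure_eq φ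
    have hne : μ ≠ 0 := by
      rintro rfl
      exact hφ (ContinuousLinearMap.ext fun g => by simp [hμ, SignMeasure.eval])
    refine ⟨μ.totalNorm⁻¹ • μ, SignMeasure.totalNorm_inv_smul hne, fun z hz => ?_, fun i hi => ?_⟩
    · rw [SignMeasure.eval_smul_left, ← hμ, hφZ z hz, mul_zero]
    · rw [SignMeasure.eval_smul_left, ← hμ, hφf ⟨i, hi⟩, mul_zero]
  choose μ h1 hZ' hf using key
  exact ⟨μ, h1, hZ', fun i n hi => hf n i hi⟩

/-- Banach–Steinhaus turns pointwise boundedness into equicontinuity, which carries the limit from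
`D` to all of `E`. -/
theorem IsSeparableFrechet.tendsto_zero_of_dense {E : Type*} [AddCommGroup E] [Module ℝ E]
    [UniformSpace E] (hE : IsSeparableFrechet E) {φ : ℕ → E →ₗ[ℝ] ℝ}
    (hφ : ∀ n, Continuous (φ n)) (hb : ∀ x, ∃ M, ∀ n, |φ n x| ≤ M) {D : Set E} (hD : Dense D)
    (h0 : ∀ x ∈ D, Tendsto (fun n => φ n x) atTop (𝓝 0)) (x : E) :
    Tendsto (fun n => φ n x) atTop (𝓝 0) := by
  have := hE.uniformAddGroup
  have := hE.continuousSMul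
  have := hE.metrizable
  have := hE.complete
  have := IsUniformAddGroup.uniformity_countably_generated (α := E)
  let ψ : ℕ → E →L[ℝ] ℝ := fun n => ⟨φ n, hφ n⟩
  have heq : UniformEquicontinuous ((↑) ∘ ψ : ℕ → E → ℝ) := by
    refine (norm_withSeminorms ℝ ℝ).banach_steinhaus fun _ x => ?_
    obtain ⟨M, hM⟩ := hb x
    exact ⟨M, by rintro _ ⟨n, rfl⟩; exact hM n⟩
  rw [Metric.tendsto_atTop]
  intro ε hε
  have hx := Metric.equicontinuousAt_iff_right.1 (heq.equicontinuous x) (ε / 2) (half_pos hε)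
  obtain ⟨y, hyD, hy⟩ := hD.inter_nhds_nonempty hx
  obtain ⟨N, hN⟩ := Metric.tendsto_atTop.1 (h0 y hyD) (ε / 2) (half_pos hε)
  refine ⟨N, fun n hn => ?_⟩
  calc dist (φ n x) 0 ≤ dist (φ n x) (φ n y) + dist (φ n y) 0 := dist_triangle _ _ _
    _ < ε / 2 + ε / 2 := add_lt_add (hy n) (hN n hn)
    _ = ε := add_halves ε

/-- Pseudocompactness makes the normalized measures pointwise bounded; the finer topology keeps the
induced functionals continuous. -/
theorem HasJNP.of_polishable_quotient {X : Type*} [TopologicalSpace X] (hX : IsPseudocompact X)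
    {Z : Submodule ℝ (Cp X)} (hZ : IsClosed (Z : Set (Cp X)))
    (hinf : ¬ FiniteDimensional ℝ (Cp X ⧸ Z)) (hpol : IsPolishable (Cp X ⧸ Z)) : HasJNP X := by
  obtain ⟨u, hut, hu⟩ := hpol
  obtain ⟨d, hd⟩ := @TopologicalSpace.exists_dense_seq _ u.toTopologicalSpace hu.separable _
  choose f hf using fun i => Z.mkQ_surjective (d i)
  obtain ⟨μ, h1, hμZ, hμf⟩ := Cp.exists_normalized_annihilating hZ hinf f
  refine ⟨μ, h1, fun g hg => ?_⟩
  let φ : ℕ → (Cp X ⧸ Z) →ₗ[ℝ] ℝ := fun n => Z.liftQ (μ n).toCLM.toLinearMap (hμZ n)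
  have hφ : ∀ n (h : Cp X), φ n (Z.mkQ h) = (μ n).eval h := fun n h => rfl
  refine @IsSeparableFrechet.tendsto_zero_of_dense _ _ _ u hu φ (fun n => ?_) (fun x => ?_) _ hd
    ?_ (Z.mkQ ⟨g, hg⟩)
  · refine continuous_le_dom hut ?_
    exact (μ n).toCLM.continuous.quotient_lift _
  · obtain ⟨h, rfl⟩ := Z.mkQ_surjective x
    obtain ⟨M, hM⟩ := hX h h.2
    refine ⟨M, fun n => ?_⟩
    have := (μ n).abs_eval_le fun x _ => hM x
    rwa [h1, mul_one] at this
  · rintro _ ⟨i, rfl⟩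
    refine tendsto_const_nhds.congr' ?_
    filter_upwards [eventually_gt_atTop i] with n hn
    rw [← hf i, hφ, hμf i n hn]

/-! ### Compact metrizable images and separable subspaces -/

theorem IsPseudocompact.isClosed_range {X M : Type*} [TopologicalSpace X] [MetricSpace M]
    (hX : IsPseudocompact X) {π : X → M} (hπ : Continuous π) : IsClosed (Set.range π) := by
  refine isClosed_of_closure_subset fun p hp => ?_
  by_contra hpr
  have hne : ∀ x, dist (π x) p ≠ 0 := fun x h => hpr ⟨x, dist_eq_zero.1 h⟩
  -- A limit point outside the range would make the reciprocal distance continuous and unbounded.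
  obtain ⟨C, hC⟩ := hX (fun x => (dist (π x) p)⁻¹) ((hπ.dist continuous_const).inv₀ hne)
  have hC0 : 0 < |C| + 1 := by positivity
  obtain ⟨_, ⟨x, rfl⟩, hx⟩ := Metric.mem_closure_iff.1 hp (|C| + 1)⁻¹ (inv_pos.2 hC0)
  rw [dist_comm] at hx
  have hpos : 0 < dist (π x) p := lt_of_le_of_ne dist_nonneg (hne x).symm
  have h1 := (lt_inv_comm₀ hpos hC0).1 hx
  have h2 := hC x
  rw [abs_of_pos (inv_pos.2 hpos)] at h2
  linarith [le_abs_self C]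

theorem IsPseudocompact.isCompact_range {X : Type*} [TopologicalSpace X]
    (hX : IsPseudocompact X) {π : X → ℕ → ℝ} (hπ : Continuous π) : IsCompact (Set.range π) := by
  choose M hM using fun n => hX (fun x => π x n) ((continuous_apply n).comp hπ)
  let _ := TopologicalSpace.metrizableSpaceMetric (ℕ → ℝ)
  refine (isCompact_univ_pi fun n => isCompact_Icc (a := -M n) (b := M n)).of_isClosed_subset
    (hX.isClosed_range hπ) ?_
  rintro _ ⟨x, rfl⟩ n -
  exact abs_le.1 (hM n x)

/-- On a pseudocompact space, a continuous function that is constant on the fibres of a continuous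
map to `ℝ^ℕ` factors continuously through its image. -/
theorem IsPseudocompact.exists_continuous_factor {X : Type*} [TopologicalSpace X]
    (hX : IsPseudocompact X) {π : X → ℕ → ℝ} (hπ : Continuous π) {f : X → ℝ} (hf : Continuous f)
    (hfπ : ∀ x y, π x = π y → f x = f y) :
    ∃ F : C(Set.range π, ℝ), ∀ x, F ⟨π x, x, rfl⟩ = f x := by
  -- Adjoin `f` as coordinate 0. Forgetting it maps a compact space onto a Hausdorff one, hence is a
  -- quotient map, through which coordinate 0 descends.
  let π' : X → ℕ → ℝ := fun x n => Nat.casesOn n (f x) (π x)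
  have hπ' : Continuous π' := continuous_pi fun n => by
    cases n with
    | zero => exact hf
    | succ n => exact (continuous_apply n).comp hπ
  have : CompactSpace (Set.range π') := isCompact_iff_compactSpace.1 (hX.isCompact_range hπ')
  let σ : Set.range π' → Set.range π := fun y => ⟨fun n => y.1 (n + 1), by
    obtain ⟨_, x, rfl⟩ := y
    exact ⟨x, rfl⟩⟩
  have hσ : Continuous σ := by
    refine Continuous.subtype_mk (f := fun (y : Set.range π') n => y.1 (n + 1)) ?_ _
    exact continuous_pi fun n => (continuous_apply (n + 1)).comp continuous_subtype_val
  have hσs : Function.Surjective σ := by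
    rintro ⟨_, x, rfl⟩
    exact ⟨⟨π' x, x, rfl⟩, rfl⟩
  have hq := IsQuotientMap.of_surjective_continuous hσs hσ
  choose s hs using fun y : Set.range π => y.2
  have hF : ∀ x, f (s ⟨π x, x, rfl⟩) = f x := fun x => hfπ _ _ (hs ⟨π x, x, rfl⟩)
  refine ⟨⟨fun y => f (s y), hq.continuous_iff.2 ?_⟩, hF⟩
  have : (fun y => f (s y)) ∘ σ = fun y => y.1 0 := by
    funext ⟨_, x, rfl⟩
    exact hF x
  rw [this]
  exact (continuous_apply 0).comp continuous_subtype_val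

/-- On a pseudocompact space, pointwise separable subspaces of `C_p(X)` are separable for uniform
convergence. -/
theorem IsPseudocompact.exists_uniformly_dense_seq {X : Type*} [TopologicalSpace X]
    (hX : IsPseudocompact X) (S : Submodule ℝ (Cp X)) [TopologicalSpace.SeparableSpace S] :
    ∃ d : ℕ → S, ∀ f : S, ∀ ε > 0, ∃ i, ∀ x, |(f.1 : X → ℝ) x - ((d i).1 : X → ℝ) x| < ε := by
  let e := TopologicalSpace.denseSeq S
  let π : X → ℕ → ℝ := fun x n => (e n).1.1 x
  have hπ : Continuous π := continuous_pi fun n => (e n).1.2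
  have : CompactSpace (Set.range π) := isCompact_iff_compactSpace.1 (hX.isCompact_range hπ)
  -- Agreement at `x` and `y` is a closed condition, so it passes from the dense sequence to all of
  -- `S`; thus `S` lives in the separable space of continuous functions on the compact image.
  have hfac : ∀ f : S, ∀ x y, π x = π y → f.1.1 x = f.1.1 y := by
    intro f x y hxy
    have hcl : IsClosed {f : S | f.1.1 x = f.1.1 y} := isClosed_eq
      ((Cp.continuous_eval x).comp continuous_subtype_val)
      ((Cp.continuous_eval y).comp continuous_subtype_val)
    exact (TopologicalSpace.denseRange_denseSeq S).induction_on f hcl fun n => congrFun hxy n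
  choose F hF using fun f : S => hX.exists_continuous_factor hπ f.1.2 (hfac f)
  have : Nonempty (Set.range F) := ⟨⟨F 0, 0, rfl⟩⟩
  choose d hd using fun i => (TopologicalSpace.denseSeq (Set.range F) i).2
  refine ⟨d, fun f ε hε => ?_⟩
  obtain ⟨i, hi⟩ := (TopologicalSpace.denseRange_denseSeq (Set.range F)).exists_dist_lt
    ⟨F f, f, rfl⟩ hε
  refine ⟨i, fun x => ?_⟩
  rw [Subtype.dist_eq, ← hd i] at hi
  rw [← hF f x, ← hF (d i) x, ← Real.dist_eq]
  exact (ContinuousMap.dist_apply_le_dist _).trans_lt hi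

theorem HasJNP.of_complemented_separable {X : Type*} [TopologicalSpace X]
    (hX : IsPseudocompact X) {S : Submodule ℝ (Cp X)} (hS : S.ClosedComplemented)
    (hinf : ¬ FiniteDimensional ℝ S) [TopologicalSpace.SeparableSpace S] : HasJNP X := by
  obtain ⟨P, hP⟩ := hS
  obtain ⟨d, hd⟩ := hX.exists_uniformly_dense_seq S
  have hPs : Function.Surjective P.toLinearMap := fun x => ⟨x, hP x⟩
  have hZinf : ¬ FiniteDimensional ℝ (Cp X ⧸ P.ker) := fun h =>
    hinf (P.toLinearMap.quotKerEquivOfSurjective hPs).finiteDimensional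
  obtain ⟨μ, h1, hμP, hμd⟩ := Cp.exists_normalized_annihilating P.isClosed_ker hZinf
    fun i => (d i).1
  refine ⟨μ, h1, fun g hg => ?_⟩
  -- The measures kill `ker P`, so only the component of `g` in `S` matters, where uniform
  -- approximation is available.
  have hμ : ∀ n, (μ n).eval g = (μ n).eval (P ⟨g, hg⟩).1 := fun n => by
    have := hμP n (⟨g, hg⟩ - (P ⟨g, hg⟩).1) (by simp [LinearMap.mem_ker, hP])
    rw [← sub_eq_zero, ← SignMeasure.eval_sub_right]
    exact this
  rw [Metric.tendsto_atTop]
  intro ε hε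
  obtain ⟨i, hi⟩ := hd (P ⟨g, hg⟩) (ε / 2) (half_pos hε)
  refine ⟨i + 1, fun n hn => ?_⟩
  have h2 := (μ n).abs_eval_le (f := (P ⟨g, hg⟩).1.1 - (d i).1.1) fun x _ => (hi x).le
  rw [SignMeasure.eval_sub_right, hμd i n hn, sub_zero, h1, mul_one] at h2
  rw [Real.dist_eq, sub_zero, hμ]
  linarith

/-! ### Polishability of `c0` via the sup norm -/

theorem IsSeparableFrechet.comap {E F : Type*} [AddCommGroup E] [Module ℝ E]
    [NormedAddCommGroup F] [NormedSpace ℝ F] [CompleteSpace F]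
    [TopologicalSpace.SeparableSpace F] (e : E ≃ₗ[ℝ] F) :
    IsSeparableFrechet E (u := UniformSpace.comap e inferInstance) := by
  let u : UniformSpace E := UniformSpace.comap e inferInstance
  have hu : IsUniformInducing e := ⟨rfl⟩
  have hemb : IsEmbedding e := ⟨hu.isInducing, e.injective⟩
  exact
    { uniformAddGroup := IsUniformAddGroup.comap e
      continuousSMul := continuousSMul_induced e
      locallyConvex := LocallyConvexSpace.induced e.toLinearMap
      metrizable := hemb.metrizableSpace
      complete := (hu.completeSpace_congr e.surjective).2 inferInstance
      separable := by
        have := UniformSpace.secondCountable_of_separable F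
        have := hemb.secondCountableTopology
        infer_instance }

/-- Continuity of the inverse says exactly that the transported norm topology is finer. -/
theorem IsPolishable.of_linearEquiv {E F : Type*} [AddCommGroup E] [Module ℝ E]
    [TopologicalSpace E] [NormedAddCommGroup F] [NormedSpace ℝ F] [CompleteSpace F]
    [TopologicalSpace.SeparableSpace F] (e : E ≃ₗ[ℝ] F) (he : Continuous e.symm) :
    IsPolishable E :=
  ⟨UniformSpace.comap e inferInstance,
    fun s hs => ⟨e.symm ⁻¹' s, hs.preimage he, by ext x; simp⟩, IsSeparableFrechet.comap e⟩

open scoped ZeroAtInfty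

/-- `c₀` as the space of functions on `ℕ` vanishing at infinity. -/
def c0.equivZeroAtInfty : c0 ≃ₗ[ℝ] C₀(ℕ, ℝ) where
  toFun x :=
    { toFun := x
      continuous_toFun := continuous_of_discreteTopology
      zero_at_infty' := by
        rw [cocompact_eq_cofinite, Nat.cofinite_eq_atTop]
        exact x.2 }
  map_add' _ _ := rfl
  map_smul' _ _ := rfl
  invFun f := ⟨f, by
    have := f.zero_at_infty'
    rwa [cocompact_eq_cofinite, Nat.cofinite_eq_atTop] at this⟩
  left_inv _ := rfl
  right_inv _ := rfl

theorem c0.continuous_equivZeroAtInfty_symm : Continuous c0.equivZeroAtInfty.symm :=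
  Continuous.subtype_mk (continuous_pi fun n =>
    (continuous_eval_const n).comp
      ZeroAtInftyContinuousMap.isometry_toBCF.continuous) _

instance ZeroAtInftyContinuousMap.separableSpace_nat :
    TopologicalSpace.SeparableSpace C₀(ℕ, ℝ) := by
  let e : ℕ → C₀(ℕ, ℝ) := fun n => c0.equivZeroAtInfty ⟨Pi.single n 1, c0.single_mem n 1⟩
  have hsep : TopologicalSpace.IsSeparable (Submodule.span ℝ (Set.range e) : Set C₀(ℕ, ℝ)) :=
    (Set.countable_range e).isSeparable.span
  refine TopologicalSpace.isSeparable_univ_iff.1 (hsep.closure.mono fun f _ => ?_)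
  have happ : ∀ N k, (∑ n ∈ Finset.range N, f n • e n) k = if k < N then f k else 0 := by
    intro N k
    have h : ∀ n, e n k = if k = n then 1 else 0 := fun n => Pi.single_apply n 1 k
    induction N with
    | zero => simp
    | succ N ih =>
      rw [Finset.sum_range_succ, ZeroAtInftyContinuousMap.add_apply, ih,
        ZeroAtInftyContinuousMap.smul_apply, h]
      rcases lt_trichotomy k N with hk | rfl | hk
      · simp [hk, hk.ne, hk.trans N.lt_succ_self]
      · simp
      · simp [hk.ne', hk.not_gt, show ¬ k < N + 1 by omega]
  refine mem_closure_of_tendsto (f := fun N => ∑ n ∈ Finset.range N, f n • e n) (b := atTop) ?_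
    (Eventually.of_forall fun N => Submodule.sum_mem _ fun n _ =>
      Submodule.smul_mem _ _ (Submodule.subset_span ⟨n, rfl⟩))
  rw [ZeroAtInftyContinuousMap.tendsto_iff_tendstoUniformly, Metric.tendstoUniformly_iff]
  intro ε hε
  obtain ⟨N, hN⟩ := Metric.tendsto_atTop.1 (c0.equivZeroAtInfty.symm f).2 ε hε
  filter_upwards [eventually_ge_atTop N] with n hn k
  rw [happ]
  split_ifs with hk
  · simpa using hε
  · exact hN k (hn.trans (not_lt.1 hk))

theorem IsPolishable.of_equiv_c0 {E : Type*} [AddCommGroup E] [Module ℝ E] [TopologicalSpace E]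
    (e : E ≃L[ℝ] c0) : IsPolishable E :=
  IsPolishable.of_linearEquiv (e.toLinearEquiv.trans c0.equivZeroAtInfty)
    (e.symm.continuous.comp c0.continuous_equivZeroAtInfty_symm)

theorem c0.not_finiteDimensional_of_equiv {E : Type*} [AddCommGroup E] [Module ℝ E]
    (e : E ≃ₗ[ℝ] c0) : ¬ FiniteDimensional ℝ E := fun _ =>
  c0.not_finiteDimensional e.finiteDimensional

/-! ### The equivalences -/

theorem theorem2p2 (X : Type*) [TopologicalSpace X] [T35Space X] :
    List.TFAE [
      HasJNP X,
      ∃ S : Submodule ℝ (Cp X), S.ClosedComplemented ∧ Nonempty (S ≃L[ℝ] c0),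
      ∃ Z : Submodule ℝ (Cp X), IsClosed (Z : Set (Cp X)) ∧ Nonempty ((Cp X ⧸ Z) ≃L[ℝ] c0)] ∧
    (IsPseudocompact X →
      List.TFAE [
        HasJNP X,
        ∃ S : Submodule ℝ (Cp X), S.ClosedComplemented ∧ Nonempty (S ≃L[ℝ] c0),
        ∃ Z : Submodule ℝ (Cp X), IsClosed (Z : Set (Cp X)) ∧ Nonempty ((Cp X ⧸ Z) ≃L[ℝ] c0),
        ∃ S : Submodule ℝ (Cp X), S.ClosedComplemented ∧ ¬ FiniteDimensional ℝ S ∧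
          TopologicalSpace.MetrizableSpace S,
        ∃ S : Submodule ℝ (Cp X), S.ClosedComplemented ∧ ¬ FiniteDimensional ℝ S ∧
          TopologicalSpace.SeparableSpace S,
        ∃ Z : Submodule ℝ (Cp X), IsClosed (Z : Set (Cp X)) ∧
          ¬ FiniteDimensional ℝ (Cp X ⧸ Z) ∧ IsPolishable (Cp X ⧸ Z)]) := by
  have h12 : HasJNP X →
      ∃ S : Submodule ℝ (Cp X), S.ClosedComplemented ∧ Nonempty (S ≃L[ℝ] c0) :=
    fun h => h.exists_complemented_c0
  have h23 : (∃ S : Submodule ℝ (Cp X), S.ClosedComplemented ∧ Nonempty (S ≃L[ℝ] c0)) →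
      ∃ Z : Submodule ℝ (Cp X), IsClosed (Z : Set (Cp X)) ∧ Nonempty ((Cp X ⧸ Z) ≃L[ℝ] c0) :=
    fun ⟨_, hS, ⟨e⟩⟩ => hS.exists_quotient_equiv e
  have h31 : (∃ Z : Submodule ℝ (Cp X), IsClosed (Z : Set (Cp X)) ∧
      Nonempty ((Cp X ⧸ Z) ≃L[ℝ] c0)) → HasJNP X := fun ⟨_, _, ⟨e⟩⟩ => HasJNP.of_quotient_c0 e
  refine ⟨?_, fun hX => ?_⟩
  · tfae_have 1 → 2 := h12
    tfae_have 2 → 3 := h23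
    tfae_have 3 → 1 := h31
    tfae_finish
  · tfae_have 1 → 2 := h12
    tfae_have 2 → 3 := h23
    tfae_have 3 → 1 := h31
    tfae_have 2 → 4 := fun ⟨S, hS, ⟨e⟩⟩ =>
      ⟨S, hS, c0.not_finiteDimensional_of_equiv e.toLinearEquiv,
        e.toHomeomorph.isEmbedding.metrizableSpace⟩
    tfae_have 4 → 5 := fun ⟨S, hS, hinf, _⟩ =>
      ⟨S, hS, hinf, Cp.separableSpace_of_metrizableSpace S⟩
    tfae_have 5 → 1 := fun ⟨_, hS, hinf, _⟩ => HasJNP.of_complemented_separable hX hS hinf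
    tfae_have 3 → 6 := fun ⟨Z, hZ, ⟨e⟩⟩ =>
      ⟨Z, hZ, c0.not_finiteDimensional_of_equiv e.toLinearEquiv, IsPolishable.of_equiv_c0 e⟩
    tfae_have 6 → 1 := fun ⟨_, hZ, hinf, hpol⟩ => HasJNP.of_polishable_quotient hX hZ hinf hpol
    tfae_finish
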